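/- **Quantum SMP model.** In a $k$-party quantum simultaneous message-passing (SMP) protocol, each of $k$ players holds an input string in $\{0,1\}^n$ and sends to a referee one message, a register of qubits whose state (a unit vector) depends only on that player's own input; there is no shared randomness and no shared entanglement. The referee, who does not know the inputs, performs a quantum measurement on all received registers jointly and produces an output. The communication cost is the total number of qubits sent by the players, maximized over the inputs. The protocol is bounded-error for a task if on every input the output is correct with probability at least $2/3$. In the number-in-hand (NIH) network model the input is a simple undirected graph $G=(V,E)$ with $V=\{1,\dots,k\}$, and player $v$ holds the neighborhood vector $\nu_v\in\{0,1\}^k$, where $\nu_v[u]=1$ iff $\{u,v\}\in E$. **Max-$d$-isolated cliques.** A set $S\subseteq V$ is a max-$d$-isolated clique of $G$ if the nodes of $S$ are pairwise adjacent and each node of $S$ has at most $d$ edges to $V\setminus S$ (so the empty set counts as one). **Theorem.** There is a universal constant $C>0$ such that for all integers $k\ge 1$ and $d\ge 1$ there is, in the NIH network model on $k$ nodes, a bounded-error quantum SMP protocol with communication cost at most $C\,k\,d\,\log_2^2 k$ in which the referee outputs the list of all max-$d$-isolated cliques of the input graph. -/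

import Mathlib

open scoped ComplexOrder

/-- A general quantum measurement with outcomes in `O` on the space `ℂ^ι` (a POVM): positive
semidefinite effects, one per outcome, that sum to the identity. -/
structure POVM (ι O : Type) [Fintype ι] [DecidableEq ι] [Fintype O] where
  effect : O → Matrix ι ι ℂ
  posSemidef : ∀ o, (effect o).PosSemidef
  sum_effect : ∑ o, effect o = 1

/-- The probability of outcome `o` when the state `ψ` is measured: `⟨ψ| M_o |ψ⟩`. -/
noncomputable def POVM.prob {ι O : Type} [Fintype ι] [DecidableEq ι] [Fintype O]
    (M : POVM ι O) (ψ : ι → ℂ) (o : O) : ℝ :=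
  (star ψ ⬝ᵥ (M.effect o).mulVec ψ).re

/-- A quantum simultaneous message-passing protocol for `k` players with `n`-bit inputs and a
referee with outputs in `O`. Player `v`, on input `x`, sends a register of `qubits v` qubits in the
state `message v x`, a unit vector whose coordinates are indexed by the computational basis; it
depends only on the player's own input, and there is no shared randomness or entanglement.
The referee measures all the received registers jointly and outputs the outcome. -/
structure QuantumSMP (k n : ℕ) (O : Type) [Fintype O] where
  qubits : Fin k → ℕ
  message : (v : Fin k) → (Fin n → Bool) → EuclideanSpace ℂ (Fin (qubits v) → Bool)
  norm_message : ∀ v x, ‖message v x‖ = 1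
  referee : POVM ((v : Fin k) → Fin (qubits v) → Bool) O

namespace QuantumSMP

variable {k n : ℕ} {O : Type} [Fintype O]

/-- The communication cost: the total number of qubits sent by the players. -/
def cost (P : QuantumSMP k n O) : ℕ := ∑ v, P.qubits v

/-- The state received by the referee: the tensor product of the players' messages. -/
noncomputable def jointState (P : QuantumSMP k n O) (x : Fin k → Fin n → Bool) :
    ((v : Fin k) → Fin (P.qubits v) → Bool) → ℂ :=
  fun b => ∏ v, P.message v (x v) (b v)

/-- The probability that the referee outputs `o` when the players' inputs are `x`. -/
noncomputable def outputProb (P : QuantumSMP k n O) (x : Fin k → Fin n → Bool) (o : O) : ℝ :=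
  P.referee.prob (P.jointState x) o

end QuantumSMP

open Classical in
/-- The neighborhood vector of the node `v`: the characteristic vector of its set of neighbors. -/
noncomputable def neighborhoodVector {k : ℕ} (G : SimpleGraph (Fin k)) (v : Fin k) :
    Fin k → Bool :=
  fun u => decide (G.Adj v u)

/-- In the number-in-hand network model (player `v` holds the neighborhood vector of the node `v`),
the protocol `P` outputs `f G` with probability at least `2/3` on every input graph `G`. -/
def QuantumSMP.SolvesNIH {k : ℕ} {O : Type} [Fintype O] (P : QuantumSMP k k O)
    (f : SimpleGraph (Fin k) → O) : Prop :=
  ∀ G : SimpleGraph (Fin k), 2 / 3 ≤ P.outputProb (neighborhoodVector G) (f G)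

/-- `S` is a max-`d`-isolated clique: it induces a clique, and each of its nodes has at most `d`
edges to nodes outside `S`. -/
def IsMaxIsolatedClique {k : ℕ} (G : SimpleGraph (Fin k)) (d : ℕ) (S : Finset (Fin k)) : Prop :=
  G.IsClique (S : Set (Fin k)) ∧
    ∀ v ∈ S, (G.neighborSet v \ (S : Set (Fin k))).ncard ≤ d

open Classical in
/-- The collection of all max-`d`-isolated cliques of `G`. -/
noncomputable def maxIsolatedCliques {k : ℕ} (d : ℕ) (G : SimpleGraph (Fin k)) :
    Finset (Finset (Fin k)) :=
  Finset.univ.filter fun S => IsMaxIsolatedClique G d S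

/-! Let N[v] be the closed neighborhood of v. If u and v lie in a max-d-isolated clique S, then N[u]
and N[v] both contain S, so their indicator vectors differ in at most 2d places. Conversely, S is
such a clique as soon as u ∈ N[v] for all u, v in S and every node of S has degree at most |S| - 1 +
d. So the referee needs only the degrees and, for each pair, the difference of the two indicators
whenever it is 2d-sparse.

The classical part of a message holds the degree and the first 4d power sums of the indicator, over
a field with at least 2k elements. Power sums are linear, and 4d of them determine a 2d-sparse
vector (`sketch_injOn`), so subtraction yields a candidate difference for each pair. The candidate
is wrong if the true difference is not sparse, and it must be verified.

Verification uses L = O(log k) copies of a fingerprint, the uniform superposition of the pairs (t,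
f(t)), where f is the polynomial whose coefficients are the indicator. A swap test shifted by the
candidate's polynomial always accepts a correct candidate; a wrong one passes with probability at
most (3/4)^L, because distinct polynomials agree on at most half of the field. Each test thus has an
almost certain result and hardly disturbs the state, so the same copies serve all k² tests
(`le_prob_sequentialTests`). The results determine the cliques (`decodeCliques_eq`). A message has
O(d + log k) field elements of O(log k) qubits each. -/

/-! ### Measurements: post-processing, relabelling, classical control -/

namespace POVM

variable {ι κ O O' : Type} [Fintype ι] [Fintype κ] [DecidableEq κ] [Fintype O] [Fintype O']

/-- The matrix on `ℂ^κ ⊗ ℂ^ι` that acts as `A c` in the block of `c`. -/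
def blockMatrix (A : κ → Matrix ι ι ℂ) : Matrix (κ × ι) (κ × ι) ℂ :=
  Matrix.of fun a b => if a.1 = b.1 then A a.1 a.2 b.2 else 0

theorem dotProduct_blockMatrix_mulVec (A : κ → Matrix ι ι ℂ) (ψ : κ × ι → ℂ) :
    star ψ ⬝ᵥ (blockMatrix A).mulVec ψ =
      ∑ c, star (fun i => ψ (c, i)) ⬝ᵥ (A c).mulVec fun i => ψ (c, i) := by
  simp only [dotProduct, Matrix.mulVec, blockMatrix, Matrix.of_apply, Pi.star_apply,
    Fintype.sum_prod_type, ite_mul, zero_mul]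
  refine Finset.sum_congr rfl fun c _ => Finset.sum_congr rfl fun i _ => ?_
  congr 1
  rw [Finset.sum_comm]
  simp

variable [DecidableEq ι]

theorem prob_nonneg (M : POVM ι O) (ψ : ι → ℂ) (o : O) : 0 ≤ M.prob ψ o :=
  (Complex.le_def.1 ((M.posSemidef o).dotProduct_mulVec_nonneg ψ)).1

/-- Classical post-processing of the outcome of a measurement. -/
def map [DecidableEq O'] (M : POVM ι O) (g : O → O') : POVM ι O' where
  effect o' := ∑ o with g o = o', M.effect o
  posSemidef o' := Matrix.posSemidef_sum _ fun o _ => M.posSemidef o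
  sum_effect := by
    rw [Finset.sum_fiberwise]
    exact M.sum_effect

theorem prob_le_prob_map [DecidableEq O'] (M : POVM ι O) (g : O → O') (ψ : ι → ℂ) (o : O) :
    M.prob ψ o ≤ (M.map g).prob ψ (g o) := by
  have h : (M.map g).prob ψ (g o) = ∑ i with g i = g o, M.prob ψ i := by
    simp only [prob, map, Matrix.sum_mulVec, dotProduct_sum, Complex.re_sum]
  rw [h]
  exact Finset.single_le_sum (f := fun i => M.prob ψ i) (fun i _ => M.prob_nonneg ψ i) (by simp)

/-- Relabelling of the computational basis. -/
def reindex (M : POVM ι O) (e : κ ≃ ι) : POVM κ O where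
  effect o := (M.effect o).submatrix e e
  posSemidef o := (M.posSemidef o).submatrix e
  sum_effect := by
    ext i j
    have := congrFun (congrFun M.sum_effect (e i)) (e j)
    simpa [Matrix.sum_apply, Matrix.one_apply] using this

theorem prob_reindex (M : POVM ι O) (e : κ ≃ ι) (ψ : ι → ℂ) (o : O) :
    (M.reindex e).prob (ψ ∘ e) o = M.prob ψ o := by
  simp only [prob, reindex, dotProduct, Matrix.mulVec, Matrix.submatrix_apply, Function.comp,
    Pi.star_apply]
  congr 1
  rw [← e.sum_comp]
  refine Finset.sum_congr rfl fun i _ => ?_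
  rw [← e.sum_comp (fun j => M.effect o (e i) j * ψ j)]

/-- The measurement that reads a classical register `κ` and then measures the register `ι` in a way
that depends on the value read. -/
def controlled (M : κ → POVM ι O) : POVM (κ × ι) O where
  effect o := blockMatrix fun c => (M c).effect o
  posSemidef o := by
    refine Matrix.PosSemidef.of_dotProduct_mulVec_nonneg ?_ fun ψ => ?_
    · ext a b
      simp only [Matrix.conjTranspose_apply, blockMatrix, Matrix.of_apply]
      by_cases h : a.1 = b.1
      · have := ((M b.1).posSemidef o).1.apply a.2 b.2
        simp [h, ← this]
      · simp [h, Ne.symm h]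
    · rw [dotProduct_blockMatrix_mulVec]
      exact Finset.sum_nonneg fun c _ => ((M c).posSemidef o).dotProduct_mulVec_nonneg _
  sum_effect := by
    ext a b
    simp only [Matrix.sum_apply, blockMatrix, Matrix.of_apply, Matrix.one_apply, Prod.ext_iff]
    by_cases h : a.1 = b.1
    · have := congrFun (congrFun (M a.1).sum_effect a.2) b.2
      simp only [Matrix.sum_apply, Matrix.one_apply] at this
      simpa [h] using this
    · simp [h]

theorem prob_controlled (M : κ → POVM ι O) (c : κ) (φ : ι → ℂ) (o : O) :
    (controlled M).prob (fun a => if a.1 = c then φ a.2 else 0) o = (M c).prob φ o := by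
  simp only [prob, controlled, dotProduct_blockMatrix_mulVec]
  rw [Finset.sum_eq_single c]
  · simp
  · intro b _ hb
    simp [hb, dotProduct]
  · simp

end POVM

/-! ### Projective tests in sequence and their disturbance -/

section SequentialTests

variable {ι : Type} [Fintype ι]

/-- The Euclidean norm of a vector of amplitudes. -/
noncomputable def amplitudeNorm (ψ : ι → ℂ) : ℝ := ‖(WithLp.toLp 2 ψ : EuclideanSpace ℂ ι)‖

theorem amplitudeNorm_nonneg (ψ : ι → ℂ) : 0 ≤ amplitudeNorm ψ := norm_nonneg _

theorem amplitudeNorm_add_le (ψ φ : ι → ℂ) :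
    amplitudeNorm (ψ + φ) ≤ amplitudeNorm ψ + amplitudeNorm φ := by
  unfold amplitudeNorm
  rw [WithLp.toLp_add]
  exact norm_add_le _ _

theorem amplitudeNorm_neg (ψ : ι → ℂ) : amplitudeNorm (-ψ) = amplitudeNorm ψ := by
  unfold amplitudeNorm
  rw [WithLp.toLp_neg, norm_neg]

theorem amplitudeNorm_sq (ψ : ι → ℂ) : amplitudeNorm ψ ^ 2 = (star ψ ⬝ᵥ ψ).re := by
  unfold amplitudeNorm
  rw [EuclideanSpace.norm_sq_eq]
  simp [dotProduct, Complex.sq_norm, Complex.normSq_apply]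

theorem re_dotProduct_le (ψ φ : ι → ℂ) :
    (star ψ ⬝ᵥ φ).re ≤ amplitudeNorm ψ * amplitudeNorm φ := by
  have h := re_inner_le_norm (𝕜 := ℂ) (WithLp.toLp 2 ψ : EuclideanSpace ℂ ι)
    (WithLp.toLp 2 φ : EuclideanSpace ℂ ι)
  rw [EuclideanSpace.inner_toLp_toLp, dotProduct_comm] at h
  exact h

/-- An orthogonal projection, as a matrix. -/
structure IsProjector (P : Matrix ι ι ℂ) : Prop where
  conjTranspose_eq : P.conjTranspose = P
  mul_self : P * P = P

namespace IsProjector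

theorem one_sub [DecidableEq ι] {P : Matrix ι ι ℂ} (h : IsProjector P) : IsProjector (1 - P) where
  conjTranspose_eq := by simp [h.conjTranspose_eq]
  mul_self := by
    rw [sub_mul, mul_sub, mul_sub, h.mul_self]
    simp

theorem amplitudeNorm_mulVec_sq {P : Matrix ι ι ℂ} (h : IsProjector P) (ψ : ι → ℂ) :
    amplitudeNorm (P.mulVec ψ) ^ 2 = (star ψ ⬝ᵥ P.mulVec ψ).re := by
  rw [amplitudeNorm_sq, Matrix.star_mulVec, h.conjTranspose_eq, ← Matrix.dotProduct_mulVec,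
    Matrix.mulVec_mulVec, h.mul_self]

theorem amplitudeNorm_mulVec_le {P : Matrix ι ι ℂ} (h : IsProjector P) (ψ : ι → ℂ) :
    amplitudeNorm (P.mulVec ψ) ≤ amplitudeNorm ψ := by
  have h1 := h.amplitudeNorm_mulVec_sq ψ
  have h2 := re_dotProduct_le ψ (P.mulVec ψ)
  have h3 := amplitudeNorm_nonneg (P.mulVec ψ)
  have h4 := amplitudeNorm_nonneg ψ
  by_contra hlt
  nlinarith

end IsProjector

variable [DecidableEq ι]

/-- The projection belonging to the result `b` of the two-outcome test `P`. -/
def testEffect (P : Matrix ι ι ℂ) (b : Bool) : Matrix ι ι ℂ := if b then P else 1 - P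

theorem isProjector_testEffect {P : Matrix ι ι ℂ} (h : IsProjector P) (b : Bool) :
    IsProjector (testEffect P b) := by
  cases b
  · exact h.one_sub
  · exact h

/-- The Kraus operators of the tests `P i` performed one after the other. -/
def krausOperator : {N : ℕ} → (Fin N → Matrix ι ι ℂ) → (Fin N → Bool) → Matrix ι ι ℂ
  | 0, _, _ => 1
  | _ + 1, P, b => testEffect (P 0) (b 0) * krausOperator (Fin.tail P) (Fin.tail b)

/-- Test 0 stands leftmost and is performed last. Summing over its two results first gives the
identity in the middle and leaves the sum for the tail. -/
theorem sum_krausOperator {N : ℕ} (P : Fin N → Matrix ι ι ℂ) (hP : ∀ i, IsProjector (P i)) :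
    ∑ b, (krausOperator P b).conjTranspose * krausOperator P b = 1 := by
  induction N with
  | zero => simp [krausOperator]
  | succ N ih =>
    rw [← (Fin.consEquiv fun _ => Bool).sum_comp, Fintype.sum_prod_type, Finset.sum_comm,
      ← ih (Fin.tail P) fun i => hP i.succ]
    refine Finset.sum_congr rfl fun b _ => ?_
    have h (c : Bool) : (krausOperator P (Fin.consEquiv (fun _ => Bool) (c, b))).conjTranspose *
        krausOperator P (Fin.consEquiv (fun _ => Bool) (c, b)) =
        (krausOperator (Fin.tail P) b).conjTranspose * testEffect (P 0) c *
          krausOperator (Fin.tail P) b := by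
      have hE := isProjector_testEffect (hP 0) c
      have hK : krausOperator P (Fin.consEquiv (fun _ => Bool) (c, b)) =
          testEffect (P 0) c * krausOperator (Fin.tail P) b := rfl
      rw [hK, Matrix.conjTranspose_mul, hE.conjTranspose_eq]
      rw [Matrix.mul_assoc, ← Matrix.mul_assoc (testEffect (P 0) c), hE.mul_self, Matrix.mul_assoc]
    simp only [h, Fintype.sum_bool, ← Matrix.add_mul, ← Matrix.mul_add]
    simp [testEffect]

/-- Disturbances add up: with E the last projection and K the earlier ones, EKψ - ψ = E(Kψ - ψ) +
(Eψ - ψ), and E does not increase the norm. -/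
theorem amplitudeNorm_krausOperator_sub_le {N : ℕ} (P : Fin N → Matrix ι ι ℂ)
    (hP : ∀ i, IsProjector (P i)) (b : Fin N → Bool) (ψ : ι → ℂ) (δ : ℝ)
    (hδ : ∀ i, amplitudeNorm ((testEffect (P i) (b i)).mulVec ψ - ψ) ≤ δ) :
    amplitudeNorm ((krausOperator P b).mulVec ψ - ψ) ≤ N * δ := by
  induction N with
  | zero => simp [krausOperator, amplitudeNorm]
  | succ N ih =>
    have h1 := ih (Fin.tail P) (fun i => hP i.succ) (Fin.tail b) fun i => hδ i.succ
    have h2 : (krausOperator P b).mulVec ψ - ψ =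
        (testEffect (P 0) (b 0)).mulVec ((krausOperator (Fin.tail P) (Fin.tail b)).mulVec ψ - ψ) +
          ((testEffect (P 0) (b 0)).mulVec ψ - ψ) := by
      rw [Matrix.mulVec_sub, Matrix.mulVec_mulVec, krausOperator]
      abel
    rw [h2]
    refine (amplitudeNorm_add_le _ _).trans ?_
    have h3 := (isProjector_testEffect (hP 0) (b 0)).amplitudeNorm_mulVec_le
      ((krausOperator (Fin.tail P) (Fin.tail b)).mulVec ψ - ψ)
    have h4 := hδ 0
    push_cast
    linarith

/-- The tests `P i` performed one after the other, as a single measurement. -/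
def sequentialTests {N : ℕ} (P : Fin N → Matrix ι ι ℂ) (hP : ∀ i, IsProjector (P i)) :
    POVM ι (Fin N → Bool) where
  effect b := (krausOperator P b).conjTranspose * krausOperator P b
  posSemidef _ := Matrix.posSemidef_conjTranspose_mul_self _
  sum_effect := sum_krausOperator P hP

/-- A union bound for measurements: if every single test has a result that hardly disturbs the unit
vector `ψ`, then all these results occur together with high probability. -/
theorem le_prob_sequentialTests {N : ℕ} (P : Fin N → Matrix ι ι ℂ)
    (hP : ∀ i, IsProjector (P i)) (b : Fin N → Bool) (ψ : ι → ℂ) (hψ : amplitudeNorm ψ = 1) (δ : ℝ)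
    (hδ : ∀ i, amplitudeNorm ((testEffect (P i) (b i)).mulVec ψ - ψ) ≤ δ) (hN : N * δ ≤ 1) :
    (1 - N * δ) ^ 2 ≤ (sequentialTests P hP).prob ψ b := by
  have h : (sequentialTests P hP).prob ψ b = amplitudeNorm ((krausOperator P b).mulVec ψ) ^ 2 := by
    rw [amplitudeNorm_sq, POVM.prob, sequentialTests, Matrix.star_mulVec,
      ← Matrix.dotProduct_mulVec, Matrix.mulVec_mulVec]
  rw [h]
  have h1 := amplitudeNorm_krausOperator_sub_le P hP b ψ δ hδ
  -- Reverse triangle inequality: ‖ψ‖ ≤ ‖Kψ‖ + ‖Kψ - ψ‖.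
  have h2 := amplitudeNorm_add_le ((krausOperator P b).mulVec ψ)
    (-((krausOperator P b).mulVec ψ - ψ))
  rw [amplitudeNorm_neg, neg_sub, add_sub_cancel, hψ] at h2
  exact pow_le_pow_left₀ (by linarith) (by linarith) 2

end SequentialTests

/-! ### Uniform superpositions -/

section UniformState

variable {B : Type} [DecidableEq B]

/-- The uniform superposition of the basis vectors in `A`. -/
noncomputable def uniformState (A : Finset B) : B → ℂ :=
  fun b => if b ∈ A then ((√(A.card : ℝ))⁻¹ : ℝ) else 0

theorem star_uniformState_mul (A : Finset B) (b c : B) :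
    star (uniformState A b) * uniformState A c =
      if b ∈ A ∧ c ∈ A then ((A.card : ℂ))⁻¹ else 0 := by
  have h : (((√(A.card : ℝ))⁻¹ : ℝ) : ℂ) * ((√(A.card : ℝ))⁻¹ : ℝ) = ((A.card : ℂ))⁻¹ := by
    rw [← Complex.ofReal_mul, ← mul_inv, Real.mul_self_sqrt (Nat.cast_nonneg _)]
    simp
  by_cases hb : b ∈ A <;> by_cases hc : c ∈ A <;> simp [uniformState, hb, hc]
  simpa using h

end UniformState

/-! ### Tensor powers and the projection onto invariant vectors -/

section TensorPower

variable {B : Type} [Fintype B]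

/-- The `L`-fold tensor power of a vector. -/
def tensorVec (L : ℕ) (φ : B → ℂ) : (Fin L → B) → ℂ := fun b => ∏ i, φ (b i)

/-- The `L`-fold tensor power of a matrix. -/
def tensorMatrix (L : ℕ) (P : Matrix B B ℂ) : Matrix (Fin L → B) (Fin L → B) ℂ :=
  Matrix.of fun b b' => ∏ i, P (b i) (b' i)

theorem sum_prod_pi (L : ℕ) (f : Fin L → B → ℂ) :
    ∑ b : Fin L → B, ∏ i, f i (b i) = ∏ i, ∑ b, f i b := by
  classical
  rw [Finset.prod_univ_sum, Fintype.piFinset_univ]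

theorem tensorMatrix_mulVec (L : ℕ) (P : Matrix B B ℂ) (φ : B → ℂ) :
    (tensorMatrix L P).mulVec (tensorVec L φ) = tensorVec L (P.mulVec φ) := by
  ext b
  simp only [tensorMatrix, tensorVec, Matrix.mulVec, dotProduct, Matrix.of_apply,
    ← Finset.prod_mul_distrib]
  exact sum_prod_pi L fun i c => P (b i) c * φ c

theorem star_tensorVec_dotProduct (L : ℕ) (φ χ : B → ℂ) :
    star (tensorVec L φ) ⬝ᵥ tensorVec L χ = (star φ ⬝ᵥ χ) ^ L := by
  simp only [tensorVec, dotProduct, Pi.star_apply, star_prod, ← Finset.prod_mul_distrib]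
  rw [sum_prod_pi L fun _ c => star (φ c) * χ c]
  simp

theorem IsProjector.tensorMatrix {P : Matrix B B ℂ} (h : IsProjector P)
    (L : ℕ) : IsProjector (tensorMatrix L P) where
  conjTranspose_eq := by
    ext b b'
    simp only [_root_.tensorMatrix, Matrix.conjTranspose_apply, Matrix.of_apply, star_prod]
    refine Finset.prod_congr rfl fun i _ => ?_
    rw [← Matrix.conjTranspose_apply, h.conjTranspose_eq]
  mul_self := by
    ext b b'
    simp only [_root_.tensorMatrix, Matrix.mul_apply, Matrix.of_apply, ← Finset.prod_mul_distrib]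
    rw [sum_prod_pi L fun i c => P (b i) c * P c (b' i)]
    simp only [← Matrix.mul_apply, h.mul_self]

variable [DecidableEq B]

/-- The projection onto the vectors that are invariant under the involution `σ` of the basis. -/
noncomputable def invariantProjector (σ : B → B) : Matrix B B ℂ :=
  Matrix.of fun b b' => ((if b = b' then 1 else 0) + if σ b = b' then 1 else 0) / 2

theorem invariantProjector_mulVec (σ : B → B) (φ : B → ℂ) (b : B) :
    (invariantProjector σ).mulVec φ b = (φ b + φ (σ b)) / 2 := by
  simp only [invariantProjector, Matrix.mulVec, dotProduct, Matrix.of_apply, div_mul_eq_mul_div,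
    ← Finset.sum_div, add_mul, Finset.sum_add_distrib, ite_mul, one_mul, zero_mul]
  simp

theorem isProjector_invariantProjector {σ : B → B} (hσ : Function.Involutive σ) :
    IsProjector (invariantProjector σ) where
  conjTranspose_eq := by
    ext b b'
    have h : (σ b' = b) = (σ b = b') := by
      rw [hσ.eq_iff]
      exact propext eq_comm
    simp only [invariantProjector, Matrix.conjTranspose_apply, Matrix.of_apply, h, eq_comm (a := b')]
    split_ifs <;> simp
  mul_self := by
    ext b b'
    have h := invariantProjector_mulVec σ (fun c => invariantProjector σ c b') b
    rw [Matrix.mul_apply]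
    refine Eq.trans h ?_
    simp only [invariantProjector, Matrix.of_apply, hσ b]
    ring

theorem star_uniformState_dotProduct_self {A : Finset B} (hA : A.Nonempty) :
    star (uniformState A) ⬝ᵥ uniformState A = 1 := by
  have h : (A.card : ℂ) ≠ 0 := by exact_mod_cast hA.card_ne_zero
  simp only [dotProduct, Pi.star_apply, star_uniformState_mul, and_self]
  simp [h]

theorem amplitudeNorm_tensorVec_uniformState (L : ℕ) {A : Finset B} (hA : A.Nonempty) :
    amplitudeNorm (tensorVec L (uniformState A)) = 1 := by
  have h : amplitudeNorm (tensorVec L (uniformState A)) ^ 2 = 1 := by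
    rw [amplitudeNorm_sq, star_tensorVec_dotProduct, star_uniformState_dotProduct_self hA]
    simp
  nlinarith [amplitudeNorm_nonneg (tensorVec L (uniformState A))]

theorem invariantProjector_mulVec_uniformState {σ : B → B} {A : Finset B}
    (h : ∀ b, σ b ∈ A ↔ b ∈ A) :
    (invariantProjector σ).mulVec (uniformState A) = uniformState A := by
  ext b
  rw [invariantProjector_mulVec]
  simp [uniformState, h]

/-- On one copy the acceptance probability is (1 + q)/2, where q ≤ 1/2 is the fraction of A that σ
maps into A. The L copies multiply. -/
theorem amplitudeNorm_tensorMatrix_invariantProjector_sq_le (L : ℕ) {σ : B → B}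
    (hσ : Function.Involutive σ) {A : Finset B} (hA : A.Nonempty)
    (h : 2 * (A.filter fun b => σ b ∈ A).card ≤ A.card) :
    amplitudeNorm ((tensorMatrix L (invariantProjector σ)).mulVec (tensorVec L (uniformState A))) ^ 2
      ≤ (3 / 4) ^ L := by
  rw [((isProjector_invariantProjector hσ).tensorMatrix L).amplitudeNorm_mulVec_sq,
    tensorMatrix_mulVec, star_tensorVec_dotProduct]
  have hdot : star (uniformState A) ⬝ᵥ (invariantProjector σ).mulVec (uniformState A) =
      (((1 + (A.filter fun b => σ b ∈ A).card / A.card) / 2 : ℝ) : ℂ) := by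
    have h1 := star_uniformState_dotProduct_self hA
    simp only [dotProduct, Pi.star_apply] at h1
    simp only [dotProduct, Pi.star_apply, invariantProjector_mulVec, mul_div_assoc', mul_add,
      ← Finset.sum_div, Finset.sum_add_distrib, h1]
    simp only [star_uniformState_mul, ← Finset.sum_filter, Finset.sum_const, nsmul_eq_mul]
    have h2 : (Finset.univ.filter fun b => b ∈ A ∧ σ b ∈ A) = A.filter fun b => σ b ∈ A := by
      ext b
      simp
    rw [h2]
    push_cast
    rw [div_eq_mul_inv (((A.filter fun b => σ b ∈ A).card : ℕ) : ℂ)]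
  rw [hdot, ← Complex.ofReal_pow, Complex.ofReal_re]
  have hpos : (0 : ℝ) < A.card := by exact_mod_cast hA.card_pos
  have h' : (2 : ℝ) * (A.filter fun b => σ b ∈ A).card ≤ A.card := by exact_mod_cast h
  have h3 : ((A.filter fun b => σ b ∈ A).card : ℝ) / A.card ≤ 1 / 2 := by
    rw [div_le_iff₀ hpos]
    linarith
  exact pow_le_pow_left₀ (by positivity) (by linarith) L

end TensorPower

/-! ### The shifted swap of two registers -/

section ShiftedSwap

variable {V F : Type} [DecidableEq V] [AddCommGroup F]

/-- Exchange the registers of `u` and `v`, with a shift by `p` of the second coordinates. -/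
def shiftedSwap (u v : V) (p : F → F) (b : V → F × F) : V → F × F := fun w =>
  if u = v then b w
  else if w = u then ((b v).1, (b v).2 + p (b v).1)
  else if w = v then ((b u).1, (b u).2 - p (b u).1)
  else b w

theorem shiftedSwap_involutive (u v : V) (p : F → F) :
    Function.Involutive (shiftedSwap (V := V) u v p) := by
  intro b
  funext w
  by_cases huv : u = v
  · simp [shiftedSwap, huv]
  · by_cases hu : w = u
    · subst hu
      simp [shiftedSwap, huv, Ne.symm huv]
    · by_cases hv : w = v
      · subst hv
        simp [shiftedSwap, huv, Ne.symm huv]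
      · simp [shiftedSwap, hu, hv]

end ShiftedSwap

/-! ### Fingerprints and their swap tests -/

section Fingerprints

variable {V F : Type} [Fintype V] [DecidableEq V] [Fintype F] [DecidableEq F]

/-- The support of the product of the fingerprints of the functions `h v`. -/
def fingerprintSupport (h : V → F → F) : Finset (V → F × F) :=
  Finset.univ.filter fun b => ∀ v, (b v).2 = h v (b v).1

/-- The fingerprint of `h`: the uniform superposition of its graph. -/
noncomputable def fingerprint (h : F → F) : F × F → ℂ :=
  fun a => if a.2 = h a.1 then ((√(Fintype.card F : ℝ))⁻¹ : ℝ) else 0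

/-- The fingerprint support is parametrized by the first coordinates. -/
def fingerprintEmbedding (h : V → F → F) : (V → F) ↪ (V → F × F) where
  toFun t v := (t v, h v (t v))
  inj' s t hst := by
    ext v
    exact congrArg Prod.fst (congrFun hst v)

theorem map_fingerprintEmbedding (h : V → F → F) :
    Finset.univ.map (fingerprintEmbedding h) = fingerprintSupport h := by
  ext b
  simp only [fingerprintEmbedding, fingerprintSupport, Finset.mem_map, Finset.mem_univ, true_and,
    Finset.mem_filter]
  constructor
  · rintro ⟨t, rfl⟩ v
    rfl
  · intro hb
    exact ⟨fun v => (b v).1, funext fun v => Prod.ext rfl (hb v).symm⟩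

theorem card_fingerprintSupport (h : V → F → F) :
    (fingerprintSupport h).card = Fintype.card F ^ Fintype.card V := by
  rw [← map_fingerprintEmbedding, Finset.card_map, Finset.card_univ, Fintype.card_fun]

/-- A product of graphs is again a set of basis vectors, so the joint state of all players is one
uniform superposition, and each test on two players' registers can act on the whole of it. -/
theorem prod_fingerprint (h : V → F → F) (b : V → F × F) :
    ∏ v, fingerprint (h v) (b v) = uniformState (fingerprintSupport h) b := by
  simp only [fingerprint, uniformState, fingerprintSupport, Finset.mem_filter, Finset.mem_univ,
    true_and, Finset.prod_ite_zero, forall_true_left]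
  refine if_congr Iff.rfl ?_ rfl
  have := card_fingerprintSupport h
  rw [fingerprintSupport] at this
  rw [this, Finset.prod_const, Finset.card_univ, ← Complex.ofReal_pow]
  congr 1
  push_cast
  rw [inv_pow, Real.sqrt_eq_rpow, Real.sqrt_eq_rpow, ← Real.rpow_natCast, ← Real.rpow_natCast,
    ← Real.rpow_mul (Nat.cast_nonneg _), ← Real.rpow_mul (Nat.cast_nonneg _), mul_comm]

variable [AddCommGroup F]

theorem shiftedSwap_mem_of_mem {u v : V} {p : F → F} {h : V → F → F}
    (hp : ∀ t, h u t = h v t + p t) {b : V → F × F} (hb : b ∈ fingerprintSupport h) :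
    shiftedSwap u v p b ∈ fingerprintSupport h := by
  simp only [fingerprintSupport, Finset.mem_filter, Finset.mem_univ, true_and] at hb ⊢
  intro w
  unfold shiftedSwap
  split_ifs with h1 h2 h3
  · exact hb w
  · subst h2
    simp [hb v, hp]
  · subst h3
    simp [hb u, hp]
  · exact hb w

theorem shiftedSwap_mem_iff {u v : V} {p : F → F} {h : V → F → F}
    (hp : ∀ t, h u t = h v t + p t) (b : V → F × F) :
    shiftedSwap u v p b ∈ fingerprintSupport h ↔ b ∈ fingerprintSupport h := by
  refine ⟨fun hb => ?_, shiftedSwap_mem_of_mem hp⟩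
  have := shiftedSwap_mem_of_mem hp hb
  rwa [shiftedSwap_involutive] at this

/-- If b and its shifted swap both lie in the support, the register of u after the swap forces the
first coordinate of `b v` to be a point where h u = h v + p. This leaves at most half of the choices
at v. -/
theorem two_mul_card_shiftedSwap_mem_le {u v : V} (huv : u ≠ v) {p : F → F} {h : V → F → F}
    (hp : 2 * (Finset.univ.filter fun t => h u t = h v t + p t).card ≤ Fintype.card F) :
    2 * ((fingerprintSupport h).filter fun b => shiftedSwap u v p b ∈ fingerprintSupport h).card ≤
      (fingerprintSupport h).card := by
  set Z := Finset.univ.filter fun t => h u t = h v t + p t with hZ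
  have hsub : ((fingerprintSupport h).filter fun b =>
      shiftedSwap u v p b ∈ fingerprintSupport h) ⊆
      (Fintype.piFinset fun w => if w = v then Z else Finset.univ).map
        (fingerprintEmbedding h) := by
    intro b hb
    rw [Finset.mem_filter] at hb
    obtain ⟨hb, hs⟩ := hb
    rw [← map_fingerprintEmbedding, Finset.mem_map] at hb
    obtain ⟨t, -, rfl⟩ := hb
    refine Finset.mem_map_of_mem _ ?_
    rw [Fintype.mem_piFinset]
    intro w
    by_cases hw : w = v
    · subst hw
      have := (Finset.mem_filter.1 hs).2 u
      simp only [shiftedSwap, huv, if_false, if_true] at this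
      rw [if_pos rfl, hZ, Finset.mem_filter]
      exact ⟨Finset.mem_univ _, this.symm⟩
    · simp [hw]
  have hcard := Finset.card_le_card hsub
  rw [Finset.card_map, Fintype.card_piFinset] at hcard
  have hprod : ∏ w, (if w = v then Z else Finset.univ).card =
      Z.card * Fintype.card F ^ (Fintype.card V - 1) := by
    rw [← Finset.mul_prod_erase _ _ (Finset.mem_univ v)]
    simp only [if_true]
    congr 1
    rw [Finset.prod_congr rfl (g := fun _ => Fintype.card F)]
    · simp [Finset.card_erase_of_mem]
    · intro w hw
      simp [Finset.ne_of_mem_erase hw]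
  have hV : Fintype.card V - 1 + 1 = Fintype.card V :=
    Nat.sub_add_cancel (Fintype.card_pos_iff.2 ⟨u⟩)
  rw [card_fingerprintSupport, ← hV, pow_succ]
  rw [hprod] at hcard
  calc _ ≤ 2 * (Z.card * Fintype.card F ^ (Fintype.card V - 1)) := by omega
    _ = 2 * Z.card * Fintype.card F ^ (Fintype.card V - 1) := by ring
    _ ≤ Fintype.card F * Fintype.card F ^ (Fintype.card V - 1) := Nat.mul_le_mul_right _ hp
    _ = _ := mul_comm _ _

/-- The swap test for `h u = h v + p` on `L` copies of the fingerprints. -/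
noncomputable def swapTest (L : ℕ) (u v : V) (p : F → F) :
    Matrix (Fin L → V → F × F) (Fin L → V → F × F) ℂ :=
  tensorMatrix L (invariantProjector (shiftedSwap u v p))

theorem isProjector_swapTest (L : ℕ) (u v : V) (p : F → F) : IsProjector (swapTest L u v p) :=
  (isProjector_invariantProjector (shiftedSwap_involutive u v p)).tensorMatrix L

open Classical in
-- If the identity holds, the state is invariant and passes undisturbed. Otherwise the expected
-- result is rejection, and the disturbance is the small accepted component. For u = v the swap is
-- the identity map and never rejects, hence the condition u ≠ v in the second alternative.
theorem amplitudeNorm_swapTest_sub_le [Nonempty F] (L : ℕ) (u v : V) (p : F → F) (h : V → F → F)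
    (hp : (∀ t, h u t = h v t + p t) ∨
      u ≠ v ∧ 2 * (Finset.univ.filter fun t => h u t = h v t + p t).card ≤ Fintype.card F)
    (δ : ℝ) (hδ : 0 ≤ δ) (hL : (3 / 4) ^ L ≤ δ ^ 2) :
    amplitudeNorm ((testEffect (swapTest L u v p) (decide (∀ t, h u t = h v t + p t))).mulVec
      (tensorVec L (uniformState (fingerprintSupport h))) -
        tensorVec L (uniformState (fingerprintSupport h))) ≤ δ := by
  by_cases heq : ∀ t, h u t = h v t + p t
  · have := invariantProjector_mulVec_uniformState (shiftedSwap_mem_iff heq)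
    simp only [heq, implies_true, decide_true, testEffect, if_true, swapTest, tensorMatrix_mulVec,
      this, sub_self]
    simpa [amplitudeNorm] using hδ
  · obtain ⟨huv, hcard⟩ := hp.resolve_left heq
    have hA : (fingerprintSupport h).Nonempty := by
      rw [← Finset.card_pos, card_fingerprintSupport]
      exact pow_pos Fintype.card_pos _
    have hle := amplitudeNorm_tensorMatrix_invariantProjector_sq_le L
      (shiftedSwap_involutive u v p) hA (two_mul_card_shiftedSwap_mem_le huv (by convert hcard))
    have hE : testEffect (swapTest L u v p) (decide (∀ t, h u t = h v t + p t)) =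
        1 - swapTest L u v p := by
      simp [heq, testEffect]
    rw [hE, Matrix.sub_mulVec, Matrix.one_mulVec, sub_sub_cancel_left, amplitudeNorm_neg]
    exact abs_le_of_sq_le_sq' (hle.trans hL) hδ |>.2

/-- The swap tests for all pairs, on `L` copies of the fingerprints. -/
theorem exists_povm_forall_swapTest [Nonempty F] (k L : ℕ)
    (hL : (3 / 4 : ℝ) ^ L ≤ (1 / (8 * k ^ 2)) ^ 2)
    (p : Fin k → Fin k → F → F) :
    ∃ M : POVM (Fin L → Fin k → F × F) (Fin k → Fin k → Prop), ∀ h : Fin k → F → F,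
      (∀ u v, (∀ t, h u t = h v t + p u v t) ∨
        u ≠ v ∧ 2 * (Finset.univ.filter fun t => h u t = h v t + p u v t).card ≤ Fintype.card F) →
      2 / 3 ≤ M.prob (tensorVec L (uniformState (fingerprintSupport h)))
        fun u v => ∀ t, h u t = h v t + p u v t := by
  classical
  let e := Fintype.equivFin (Fin k × Fin k)
  let P := fun i => swapTest L (e.symm i).1 (e.symm i).2 (p (e.symm i).1 (e.symm i).2)
  have hP : ∀ i, IsProjector (P i) := fun i => isProjector_swapTest _ _ _ _
  refine ⟨(sequentialTests P hP).map fun b u v => b (e (u, v)) = true, fun h hh => ?_⟩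
  have hA : (fingerprintSupport h).Nonempty := by
    rw [← Finset.card_pos, card_fingerprintSupport]
    exact pow_pos Fintype.card_pos _
  -- With k² tests of disturbance 1/(8k²) the total is at most 1/8, and (7/8)² > 2/3.
  have hN : ((Fintype.card (Fin k × Fin k) : ℕ) : ℝ) * (1 / (8 * k ^ 2)) ≤ 1 / 8 := by
    rcases Nat.eq_zero_or_pos k with rfl | hk
    · simp
    · have : (0 : ℝ) < k := by exact_mod_cast hk
      simp only [Fintype.card_prod, Fintype.card_fin]
      push_cast
      apply le_of_eq
      field_simp
  have h0 : (0 : ℝ) ≤ 1 / (8 * k ^ 2) := by positivity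
  have hseq := le_prob_sequentialTests P hP
    (fun i => decide (∀ t, h (e.symm i).1 t = h (e.symm i).2 t + p (e.symm i).1 (e.symm i).2 t))
    (tensorVec L (uniformState (fingerprintSupport h)))
    (amplitudeNorm_tensorVec_uniformState L hA) (1 / (8 * k ^ 2))
    (fun i => by
      convert amplitudeNorm_swapTest_sub_le L (e.symm i).1 (e.symm i).2 _ h (by convert hh _ _) _
        h0 hL)
    (by linarith)
  have hmap := (sequentialTests P hP).prob_le_prob_map (fun b u v => b (e (u, v)) = true)
    (tensorVec L (uniformState (fingerprintSupport h)))
    (fun i => decide (∀ t, h (e.symm i).1 t = h (e.symm i).2 t + p (e.symm i).1 (e.symm i).2 t))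
  simp only [Equiv.symm_apply_apply, decide_eq_true_eq] at hmap
  refine le_trans ?_ (hseq.trans hmap)
  nlinarith

end Fingerprints

/-! ### Polynomials, power sums and sparse recovery -/

section Sketch

variable {F : Type} [Field F] {k : ℕ}

/-- The value at `t` of the polynomial with coefficients `D`. -/
def polyValue (D : Fin k → F) (t : F) : F := ∑ w, D w * t ^ (w : ℕ)

/-- The first `r` power sums of `D` at the nodes `α`. -/
def sketch (α : Fin k → F) (r : ℕ) (D : Fin k → F) : Fin r → F :=
  fun j => ∑ w, D w * α w ^ (j : ℕ)

theorem polyValue_add (D D' : Fin k → F) (t : F) :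
    polyValue (D + D') t = polyValue D t + polyValue D' t := by
  simp [polyValue, add_mul, Finset.sum_add_distrib]

theorem polyValue_sub (D D' : Fin k → F) (t : F) :
    polyValue (D - D') t = polyValue D t - polyValue D' t := by
  simp [polyValue, sub_mul, Finset.sum_sub_distrib]

theorem sketch_sub (α : Fin k → F) (r : ℕ) (D D' : Fin k → F) :
    sketch α r (D - D') = sketch α r D - sketch α r D' := by
  ext j
  simp [sketch, sub_mul, Finset.sum_sub_distrib]

variable [DecidableEq F]

/-- The set of nonzero coordinates. -/
def coordSupport (D : Fin k → F) : Finset (Fin k) := Finset.univ.filter fun w => D w ≠ 0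

/-- A nonzero polynomial has no more roots than its degree. Over a field with at least 2k elements,
polynomials of two distinct vectors therefore agree on at most half of the points, as the swap test
needs. -/
theorem card_polyValue_eq_zero_le [Fintype F] {D : Fin k → F} (hD : D ≠ 0) :
    (Finset.univ.filter fun t => polyValue D t = 0).card ≤ k := by
  obtain ⟨w₀, hw₀⟩ := Function.ne_iff.1 hD
  let q : Polynomial F := ∑ w : Fin k, Polynomial.monomial (w : ℕ) (D w)
  have hq : q ≠ 0 := by
    intro h
    have : q.coeff w₀ = D w₀ := by
      simp [q, Polynomial.coeff_monomial, Fin.val_inj]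
    rw [h, Polynomial.coeff_zero] at this
    exact hw₀ this.symm
  have hdeg : q.natDegree ≤ k :=
    Polynomial.natDegree_sum_le_of_forall_le _ _ fun w _ =>
      (Polynomial.natDegree_monomial_le _).trans w.2.le
  have hsub : (Finset.univ.filter fun t => polyValue D t = 0) ⊆ q.roots.toFinset := by
    intro t ht
    rw [Multiset.mem_toFinset, Polynomial.mem_roots hq, Polynomial.IsRoot.def]
    have ht := (Finset.mem_filter.1 ht).2
    simpa [q, Polynomial.eval_finsetSum, Polynomial.eval_monomial, polyValue] using ht
  calc _ ≤ q.roots.toFinset.card := Finset.card_le_card hsub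
    _ ≤ Multiset.card q.roots := Multiset.toFinset_card_le _
    _ ≤ q.natDegree := Polynomial.card_roots' q
    _ ≤ k := hdeg

/-- A Vandermonde argument: the polynomial g that vanishes at the nodes of the support other than w₀
has degree below r, so the vanishing power sums give ∑ D w · g(α w) = 0. Only the term of w₀
survives, and it is nonzero. -/
theorem eq_zero_of_sketch_eq_zero {α : Fin k → F} (hα : Function.Injective α) {r : ℕ}
    {D : Fin k → F} (hD : (coordSupport D).card ≤ r) (hs : sketch α r D = 0) : D = 0 := by
  by_contra hne
  obtain ⟨w₀, hw₀⟩ := Function.ne_iff.1 hne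
  have hmem : w₀ ∈ coordSupport D := by simpa [coordSupport] using hw₀
  let g : Polynomial F := ∏ w ∈ (coordSupport D).erase w₀, (Polynomial.X - Polynomial.C (α w))
  have hdeg : g.natDegree < r := by
    rw [Polynomial.natDegree_prod_of_monic _ _ fun w _ => Polynomial.monic_X_sub_C _]
    simp only [Polynomial.natDegree_X_sub_C, Finset.sum_const, smul_eq_mul, mul_one]
    exact (Finset.card_erase_lt_of_mem hmem).trans_le hD
  have hzero : ∑ w, D w * g.eval (α w) = 0 := by
    simp only [Polynomial.eval_eq_sum_range' hdeg, Finset.mul_sum]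
    rw [Finset.sum_comm]
    refine Finset.sum_eq_zero fun j hj => ?_
    have := congrFun hs ⟨j, Finset.mem_range.1 hj⟩
    simp only [sketch, Pi.zero_apply] at this
    simp only [mul_left_comm (D _), ← Finset.mul_sum, this, mul_zero]
  rw [Finset.sum_eq_single w₀] at hzero
  · refine (mul_ne_zero hw₀ ?_) hzero
    rw [Polynomial.eval_prod, Finset.prod_ne_zero_iff]
    intro w hw
    simpa [sub_eq_zero] using hα.ne (Finset.ne_of_mem_erase hw).symm
  · intro w _ hw
    by_cases hDw : D w = 0
    · simp [hDw]
    · rw [Polynomial.eval_prod, Finset.prod_eq_zero (i := w), mul_zero]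
      · simp [coordSupport, hw, hDw]
      · simp
  · simp

/-- The difference of two s-sparse vectors is 2s-sparse, hence twice as many power sums as nonzero
coordinates. -/
theorem sketch_injOn {α : Fin k → F} (hα : Function.Injective α) {s r : ℕ} (hr : 2 * s ≤ r)
    {D D' : Fin k → F} (hD : (coordSupport D).card ≤ s) (hD' : (coordSupport D').card ≤ s)
    (h : sketch α r D = sketch α r D') : D = D' := by
  refine sub_eq_zero.1 (eq_zero_of_sketch_eq_zero hα (r := r) ?_ (by rw [sketch_sub, h, sub_self]))
  have hsub : coordSupport (D - D') ⊆ coordSupport D ∪ coordSupport D' := by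
    intro w
    simp only [coordSupport, Finset.mem_filter, Finset.mem_univ, true_and, Finset.mem_union,
      Pi.sub_apply]
    contrapose!
    rintro ⟨h1, h2⟩
    simp [h1, h2]
  have := (Finset.card_le_card hsub).trans (Finset.card_union_le _ _)
  omega

open Classical in
/-- The vector with at most `s` nonzero coordinates and with sketch `y`, or `0` if there is none. -/
noncomputable def sparseRecovery (α : Fin k → F) (s : ℕ) {r : ℕ} (y : Fin r → F) : Fin k → F :=
  if h : ∃ D : Fin k → F, (coordSupport D).card ≤ s ∧ sketch α r D = y then h.choose else 0

theorem sparseRecovery_sketch {α : Fin k → F} (hα : Function.Injective α) {s r : ℕ}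
    (hr : 2 * s ≤ r) {D : Fin k → F} (hD : (coordSupport D).card ≤ s) :
    sparseRecovery α s (sketch α r D) = D := by
  have h : ∃ D' : Fin k → F, (coordSupport D').card ≤ s ∧ sketch α r D' = sketch α r D :=
    ⟨D, hD, rfl⟩
  rw [sparseRecovery, dif_pos h]
  exact sketch_injOn hα hr h.choose_spec.1 hD h.choose_spec.2

end Sketch

/-! ### Isolated cliques from degrees and verified differences -/

section Decoding

variable {F : Type} [Field F] [DecidableEq F] {k : ℕ}

/-- The characteristic vector of the closed neighborhood of `v`. -/
def closedIndicator (F : Type) [Field F] (v : Fin k) (x : Fin k → Bool) : Fin k → F :=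
  fun w => if w = v ∨ x w = true then 1 else 0

/-- The number of ones of a bit string. -/
def bitCount (x : Fin k → Bool) : ℕ := (Finset.univ.filter fun w => x w = true).card

theorem bitCount_le (x : Fin k → Bool) : bitCount x ≤ k := by
  simpa [bitCount] using Finset.card_filter_le (Finset.univ : Finset (Fin k)) fun w => x w = true

open Classical in
/-- The reconstruction of the isolated cliques from the degrees `deg`, the candidates `D u v` for
the difference of the closed neighborhoods of `u` and `v`, and the pairs `R` for which the
candidate is correct. -/
noncomputable def decodeCliques (d : ℕ) (deg : Fin k → ℕ) (D : Fin k → Fin k → Fin k → F)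
    (R : Fin k → Fin k → Prop) : Finset (Finset (Fin k)) :=
  Finset.univ.filter fun S => ∀ u ∈ S, deg u + 1 ≤ d + S.card ∧ ∀ v ∈ S, R u v ∧ D u v u = 0

theorem bitCount_neighborhoodVector (G : SimpleGraph (Fin k)) (v : Fin k) (S : Finset (Fin k)) :
    bitCount (neighborhoodVector G v) =
      (G.neighborSet v ∩ S).ncard + (G.neighborSet v \ S).ncard := by
  classical
  rw [Set.ncard_inter_add_ncard_sdiff_eq_ncard _ _ (Set.toFinite _), bitCount,
    Set.ncard_eq_toFinset_card']
  congr 1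
  ext w
  simp [neighborhoodVector]

/-- A node is not its own neighbor, so at most |S| - 1 of its neighbors lie in S, and at most d lie
outside. -/
theorem bitCount_le_of_isMaxIsolatedClique {G : SimpleGraph (Fin k)} {d : ℕ} {S : Finset (Fin k)}
    (h : IsMaxIsolatedClique G d S) {v : Fin k} (hv : v ∈ S) :
    bitCount (neighborhoodVector G v) + 1 ≤ d + S.card := by
  rw [bitCount_neighborhoodVector G v S]
  have h1 := h.2 v hv
  have h2 : (G.neighborSet v ∩ S).ncard < S.card := by
    rw [← Set.ncard_coe_finset]
    refine Set.ncard_lt_ncard ?_ (Set.toFinite _)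
    refine (Set.ssubset_iff_of_subset Set.inter_subset_right).2 ⟨v, hv, ?_⟩
    simp
  omega

/-- Both closed neighborhoods contain all of S, so they differ only at outside neighbors of u or v,
at most d for each. Open neighborhoods would also differ at u and v themselves. -/
theorem card_coordSupport_closedIndicator_sub_le {G : SimpleGraph (Fin k)} {d : ℕ}
    {S : Finset (Fin k)} (h : IsMaxIsolatedClique G d S) {u v : Fin k} (hu : u ∈ S) (hv : v ∈ S) :
    (coordSupport (closedIndicator F u (neighborhoodVector G u) -
      closedIndicator F v (neighborhoodVector G v))).card ≤ 2 * d := by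
  have hin : ∀ u ∈ S, ∀ w ∈ S, closedIndicator F u (neighborhoodVector G u) w = 1 := by
    intro u hu w hw
    by_cases huw : w = u
    · simp [closedIndicator, huw]
    · simp [closedIndicator, neighborhoodVector, h.1 hu hw (Ne.symm huw)]
  have hout : ∀ u, ∀ w ∉ G.neighborSet u, w ≠ u →
      closedIndicator F u (neighborhoodVector G u) w = 0 := by
    intro u w hw hne
    have : ¬ G.Adj u w := hw
    simp [closedIndicator, neighborhoodVector, hne, this]
  have hsub : (coordSupport (closedIndicator F u (neighborhoodVector G u) -
      closedIndicator F v (neighborhoodVector G v)) : Set (Fin k)) ⊆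
      (G.neighborSet u \ S) ∪ (G.neighborSet v \ S) := by
    intro w hw
    simp only [coordSupport, Finset.coe_filter, Finset.mem_univ, true_and, Set.mem_ofPred_eq,
      Pi.sub_apply] at hw
    have hwS : w ∉ S := fun hwS => hw (by rw [hin u hu w hwS, hin v hv w hwS, sub_self])
    by_contra hn
    simp only [Set.mem_union, Set.mem_sdiff, Finset.mem_coe, hwS, not_false_eq_true, and_true,
      not_or] at hn
    refine hw ?_
    rw [hout u w hn.1 (by rintro rfl; exact hwS hu), hout v w hn.2 (by rintro rfl; exact hwS hv),
      sub_self]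
  rw [← Set.ncard_coe_finset]
  have h1 := Set.ncard_le_ncard hsub (Set.toFinite _)
  have h2 := Set.ncard_union_le (G.neighborSet u \ (S : Set (Fin k))) (G.neighborSet v \ S)
  have h3 := h.2 u hu
  have h4 := h.2 v hv
  omega

/-- A correct candidate that vanishes at u shows that u ∈ N[v], as u ∈ N[u]; so an accepted set is a
clique, and the degree bound then limits the outside edges to d. Conversely, inside an isolated
clique the differences are 2d-sparse, hence recovered exactly. -/
theorem decodeCliques_eq {α : Fin k → F} (hα : Function.Injective α) {d r : ℕ} (hr : 4 * d ≤ r)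
    (G : SimpleGraph (Fin k)) (D : Fin k → Fin k → Fin k → F)
    (hD : ∀ u v, D u v = sparseRecovery α (2 * d)
      (sketch α r (closedIndicator F u (neighborhoodVector G u)) -
        sketch α r (closedIndicator F v (neighborhoodVector G v)))) :
    decodeCliques d (fun v => bitCount (neighborhoodVector G v)) D
      (fun u v => closedIndicator F u (neighborhoodVector G u) =
        closedIndicator F v (neighborhoodVector G v) + D u v) = maxIsolatedCliques d G := by
  classical
  ext S
  simp only [decodeCliques, maxIsolatedCliques, Finset.mem_filter, Finset.mem_univ, true_and]
  constructor
  · intro h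
    have hadj : ∀ u ∈ S, ∀ v ∈ S, u ≠ v → G.Adj u v := by
      intro u hu v hv huv
      obtain ⟨h1, h2⟩ := (h u hu).2 v hv
      have h3 := congrFun h1 u
      rw [Pi.add_apply, h2, add_zero] at h3
      have h4 : G.Adj v u := by
        by_contra hn
        simp [closedIndicator, neighborhoodVector, huv, hn] at h3
      exact h4.symm
    refine ⟨fun u hu v hv huv => hadj u hu v hv huv, fun v hv => ?_⟩
    have h1 := (h v hv).1
    rw [bitCount_neighborhoodVector G v S] at h1
    have h2 : S.card - 1 ≤ (G.neighborSet v ∩ S).ncard := by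
      rw [← Finset.card_erase_of_mem hv, ← Set.ncard_coe_finset]
      refine Set.ncard_le_ncard ?_ (Set.toFinite _)
      intro w hw
      have hw := Finset.mem_erase.1 (Finset.mem_coe.1 hw)
      exact ⟨hadj v hv w hw.2 hw.1.symm, hw.2⟩
    have h3 := Finset.card_pos.2 ⟨v, hv⟩
    omega
  · intro h u hu
    refine ⟨bitCount_le_of_isMaxIsolatedClique h hu, fun v hv => ?_⟩
    have hDuv : D u v = closedIndicator F u (neighborhoodVector G u) -
        closedIndicator F v (neighborhoodVector G v) := by
      rw [hD, ← sketch_sub, sparseRecovery_sketch hα (by omega)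
        (card_coordSupport_closedIndicator_sub_le h hu hv)]
    refine ⟨by rw [hDuv]; abel, ?_⟩
    rw [hDuv]
    by_cases huv : u = v
    · simp [huv]
    · have : G.Adj v u := h.1 hv hu (Ne.symm huv)
      simp [closedIndicator, neighborhoodVector, this]

end Decoding

/-! ### The protocol, its correctness and its cost -/

section Protocol

theorem sum_norm_fingerprint_sq {F : Type} [Fintype F] [DecidableEq F] [Nonempty F] (h : F → F) :
    ∑ a, ‖fingerprint h a‖ ^ 2 = 1 := by
  have hF : (Fintype.card F : ℝ) ≠ 0 := by exact_mod_cast Fintype.card_ne_zero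
  rw [Fintype.sum_prod_type]
  have (t : F) : ∑ y, ‖fingerprint h (t, y)‖ ^ 2 = (Fintype.card F : ℝ)⁻¹ := by
    rw [Finset.sum_eq_single (h t)]
    · simp only [fingerprint, if_true, Complex.norm_real, norm_inv, Real.norm_eq_abs, inv_pow,
        sq_abs, Real.sq_sqrt (Nat.cast_nonneg _)]
    · intro y _ hy
      simp [fingerprint, hy]
    · simp
  simp [this, hF]

/-- The message that consists of a classical part `c` and of `L` fingerprints of `h`. -/
noncomputable def messageState {κ F : Type} [DecidableEq κ] [Fintype F] [DecidableEq F] (L : ℕ)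
    (c : κ) (h : F → F) : κ × (Fin L → F × F) → ℂ :=
  fun a => if a.1 = c then tensorVec L (fingerprint h) a.2 else 0

theorem sum_norm_messageState_sq {κ F : Type} [Fintype κ] [DecidableEq κ] [Fintype F]
    [DecidableEq F] [Nonempty F] (L : ℕ) (c : κ) (h : F → F) :
    ∑ a, ‖messageState L c h a‖ ^ 2 = 1 := by
  rw [Fintype.sum_prod_type, Finset.sum_eq_single c]
  · simp only [messageState, if_true, tensorVec, norm_prod, ← Finset.prod_pow]
    have := Finset.prod_univ_sum (fun _ : Fin L => (Finset.univ : Finset (F × F)))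
      (fun _ a => ‖fingerprint h a‖ ^ 2)
    rw [Fintype.piFinset_univ] at this
    rw [← this]
    simp [sum_norm_fingerprint_sq]
  · intro b _ hb
    simp [messageState, hb]
  · simp

theorem prod_messageState {κ F : Type} [DecidableEq κ] [Fintype F] [DecidableEq F] {k : ℕ} (L : ℕ)
    (c : Fin k → κ) (h : Fin k → F → F) (b : Fin k → κ × (Fin L → F × F)) :
    ∏ v, messageState L (c v) (h v) (b v) =
      if (fun v => (b v).1) = c then
        tensorVec L (uniformState (fingerprintSupport h)) fun i v => (b v).2 i
      else 0 := by
  simp only [messageState, Finset.prod_ite_zero, Finset.mem_univ, forall_true_left]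
  refine if_congr funext_iff.symm ?_ rfl
  simp only [tensorVec]
  rw [Finset.prod_comm]
  exact Finset.prod_congr rfl fun i _ => prod_fingerprint h fun v => (b v).2 i

/-- Split the registers of all players into their classical and quantum parts. -/
def splitRegisters {k n L : ℕ} {κ X : Type} (e : (Fin n → Bool) ≃ κ × (Fin L → X)) :
    (Fin k → Fin n → Bool) ≃ (Fin k → κ) × (Fin L → Fin k → X) :=
  ((Equiv.piCongrRight fun _ => e).trans (Equiv.arrowProdEquivProdArrow _ _ _)).trans
    (Equiv.prodCongr (Equiv.refl _) (Equiv.piComm _))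

/-- The protocol in which player `v` on input `x` sends the classical message `c v x` together with
`L` fingerprints of `h v x`, and the referee measures the fingerprints by a measurement that depends
on the classical messages. -/
noncomputable def fingerprintProtocol {k N n L : ℕ} {κ F O : Type} [Fintype κ] [DecidableEq κ]
    [Fintype F] [DecidableEq F] [Nonempty F] [Fintype O]
    (e : (Fin n → Bool) ≃ κ × (Fin L → F × F)) (c : Fin k → (Fin N → Bool) → κ)
    (h : Fin k → (Fin N → Bool) → F → F)
    (M : (Fin k → κ) → POVM (Fin L → Fin k → F × F) O) : QuantumSMP k N O where
  qubits _ := n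
  message v x := WithLp.toLp 2 (messageState L (c v x) (h v x) ∘ e)
  norm_message v x := by
    rw [EuclideanSpace.norm_eq]
    simp only [Function.comp]
    rw [e.sum_comp fun a => ‖messageState L (c v x) (h v x) a‖ ^ 2, sum_norm_messageState_sq,
      Real.sqrt_one]
  referee := (POVM.controlled M).reindex (splitRegisters e)

theorem cost_fingerprintProtocol {k N n L : ℕ} {κ F O : Type} [Fintype κ] [DecidableEq κ]
    [Fintype F] [DecidableEq F] [Nonempty F] [Fintype O]
    (e : (Fin n → Bool) ≃ κ × (Fin L → F × F)) (c : Fin k → (Fin N → Bool) → κ)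
    (h : Fin k → (Fin N → Bool) → F → F) (M : (Fin k → κ) → POVM (Fin L → Fin k → F × F) O) :
    (fingerprintProtocol e c h M).cost = k * n := by
  simp [QuantumSMP.cost, fingerprintProtocol]

theorem outputProb_fingerprintProtocol {k N n L : ℕ} {κ F O : Type} [Fintype κ] [DecidableEq κ]
    [Fintype F] [DecidableEq F] [Nonempty F] [Fintype O]
    (e : (Fin n → Bool) ≃ κ × (Fin L → F × F)) (c : Fin k → (Fin N → Bool) → κ)
    (h : Fin k → (Fin N → Bool) → F → F) (M : (Fin k → κ) → POVM (Fin L → Fin k → F × F) O)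
    (x : Fin k → Fin N → Bool) (o : O) :
    (fingerprintProtocol e c h M).outputProb x o =
      (M fun v => c v (x v)).prob
        (tensorVec L (uniformState (fingerprintSupport fun v => h v (x v)))) o := by
  have hstate : (fingerprintProtocol e c h M).jointState x =
      (fun a : (Fin k → κ) × (Fin L → Fin k → F × F) =>
        if a.1 = fun v => c v (x v) then
          tensorVec L (uniformState (fingerprintSupport fun v => h v (x v))) a.2
        else 0) ∘ splitRegisters e := by
    funext b
    exact prod_messageState L (fun v => c v (x v)) (fun v => h v (x v)) fun v => e (b v)
  rw [QuantumSMP.outputProb, hstate, ← POVM.prob_controlled]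
  exact POVM.prob_reindex (POVM.controlled M) (splitRegisters e) _ o

/-- A message holds 1 field element for the degree, 4d for the power sums and 2 for each of the L
fingerprints, at m qubits per element. The bound 2k ≤ |F| provides room for the k + 1 possible
degree values and makes wrong candidates disagree on half of the field. -/
theorem exists_protocol_maxIsolatedCliques {F : Type} [Field F] [Fintype F] [DecidableEq F]
    {k d L m : ℕ} (hk : 1 ≤ k) (hF : Fintype.card F = 2 ^ m) (hkF : 2 * k ≤ Fintype.card F)
    (hL : (3 / 4 : ℝ) ^ L ≤ (1 / (8 * k ^ 2)) ^ 2) :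
    ∃ P : QuantumSMP k k (Finset (Finset (Fin k))),
      P.cost = k * (m * (1 + 4 * d + 2 * L)) ∧ P.SolvesNIH (maxIsolatedCliques d) := by
  classical
  -- One embedding of 0, …, k serves both to encode the degrees and, restricted to the first k
  -- values, to supply the nodes of the power sums.
  obtain ⟨β⟩ : Nonempty (Fin (k + 1) ↪ F) :=
    Function.Embedding.nonempty_of_card_le (by rw [Fintype.card_fin]; omega)
  let α : Fin k → F := fun w => β w.castSucc
  have hα : Function.Injective α := β.injective.comp (Fin.castSucc_injective k)
  -- Since |F| is a power of two, the message space is exactly a register of qubits, without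
  -- padding.
  have hcard : Fintype.card (Fin (m * (1 + 4 * d + 2 * L)) → Bool) =
      Fintype.card ((F × (Fin (4 * d) → F)) × (Fin L → F × F)) := by
    simp only [Fintype.card_fun, Fintype.card_prod, Fintype.card_fin, Fintype.card_bool, hF]
    ring
  let e := Fintype.equivOfCardEq hcard
  let c : Fin k → (Fin k → Bool) → F × (Fin (4 * d) → F) := fun v x =>
    (β ⟨bitCount x, Nat.lt_succ_of_le (bitCount_le x)⟩, sketch α (4 * d) (closedIndicator F v x))
  let h : Fin k → (Fin k → Bool) → F → F := fun v x => polyValue (closedIndicator F v x)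
  let D : (Fin k → F × (Fin (4 * d) → F)) → Fin k → Fin k → Fin k → F := fun y u v =>
    sparseRecovery α (2 * d) ((y u).2 - (y v).2)
  let deg : (Fin k → F × (Fin (4 * d) → F)) → Fin k → ℕ := fun y v =>
    (Function.invFun β (y v).1 : Fin (k + 1))
  choose M hM using fun y : Fin k → F × (Fin (4 * d) → F) =>
    exists_povm_forall_swapTest k L hL fun u v => polyValue (D y u v)
  refine ⟨fingerprintProtocol e c h fun y => (M y).map (decodeCliques d (deg y) (D y)),
    cost_fingerprintProtocol _ _ _ _, fun G => ?_⟩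
  rw [outputProb_fingerprintProtocol]
  set y := fun v => c v (neighborhoodVector G v) with hy
  -- On the diagonal the recovered candidate is 0, which is correct; this supplies the u ≠ v
  -- required for wrong candidates.
  have hzero (u : Fin k) : D y u u = 0 := by
    have := sparseRecovery_sketch hα (s := 2 * d) (r := 4 * d) (by omega) (D := 0)
      (by simp [coordSupport])
    rw [← sub_self (0 : Fin k → F), sketch_sub, sub_self, sub_self] at this
    simpa [D] using this
  have hcount (u v : Fin k) (huv : closedIndicator F u (neighborhoodVector G u) ≠
      closedIndicator F v (neighborhoodVector G v) + D y u v) :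
      2 * (Finset.univ.filter fun t => h u (neighborhoodVector G u) t =
        h v (neighborhoodVector G v) t + polyValue (D y u v) t).card ≤ Fintype.card F := by
    have := card_polyValue_eq_zero_le (sub_ne_zero.2 huv)
    simp only [polyValue_sub, polyValue_add, sub_eq_zero] at this
    exact (Nat.mul_le_mul_left 2 this).trans hkF
  have hiff (u v : Fin k) : (∀ t, h u (neighborhoodVector G u) t =
      h v (neighborhoodVector G v) t + polyValue (D y u v) t) ↔
      closedIndicator F u (neighborhoodVector G u) =
        closedIndicator F v (neighborhoodVector G v) + D y u v := by
    constructor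
    · intro ht
      by_contra hne
      have := hcount u v hne
      simp only [ht, Finset.filter_true, Finset.card_univ] at this
      omega
    · intro heq t
      simp only [h]
      rw [heq, polyValue_add]
  have hprob := hM y (fun v => h v (neighborhoodVector G v)) fun u v => by
    by_cases heq : closedIndicator F u (neighborhoodVector G u) =
        closedIndicator F v (neighborhoodVector G v) + D y u v
    · exact Or.inl ((hiff u v).2 heq)
    · refine Or.inr ⟨?_, hcount u v heq⟩
      rintro rfl
      exact heq (by rw [hzero, add_zero])
  refine (hprob.trans ((M y).prob_le_prob_map (decodeCliques d (deg y) (D y)) _ _)).trans_eq ?_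
  congr 1
  simp only [hiff]
  have hdeg : deg y = fun v => bitCount (neighborhoodVector G v) := by
    funext v
    simp only [deg, hy, c]
    rw [Function.leftInverse_invFun β.injective]
  rw [hdeg]
  exact decodeCliques_eq hα le_rfl G (D y) fun u v => rfl

/-- On at most one node no communication is needed. -/
theorem exists_protocol_of_subsingleton {k : ℕ} (hk : k ≤ 1) {O : Type} [Fintype O]
    (f : SimpleGraph (Fin k) → O) : ∃ P : QuantumSMP k k O, P.cost = 0 ∧ P.SolvesNIH f := by
  classical
  have : Subsingleton (Fin k) := Fin.subsingleton_iff_le_one.2 hk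
  let P : QuantumSMP k k O :=
    { qubits := fun _ => 0
      message := fun _ _ => WithLp.toLp 2 fun _ => 1
      norm_message := fun _ _ => by simp [EuclideanSpace.norm_eq]
      referee :=
        { effect := fun o => if o = f ⊥ then 1 else 0
          posSemidef := fun o => by
            split_ifs
            · exact Matrix.PosSemidef.one
            · exact Matrix.PosSemidef.zero
          sum_effect := by simp } }
  refine ⟨P, by simp [QuantumSMP.cost, P], fun G => ?_⟩
  rw [Subsingleton.elim G ⊥]
  simp [QuantumSMP.outputProb, POVM.prob, P, QuantumSMP.jointState, dotProduct]
  norm_num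

/-- Since (3/4)³ < 1/2, an exponent 3(4l + 6) gives at most 2^(-4l - 6) = (1/(8 · (2^l)²))², where l
is `Nat.clog 2 k` and k ≤ 2^l. -/
theorem three_fourths_pow_le {k : ℕ} (hk : 1 ≤ k) :
    (3 / 4 : ℝ) ^ (12 * Nat.clog 2 k + 18) ≤ (1 / (8 * k ^ 2)) ^ 2 := by
  have h1 : (k : ℝ) ≤ 2 ^ Nat.clog 2 k := by exact_mod_cast Nat.le_pow_clog one_lt_two k
  have hk0 : (0 : ℝ) < k := by exact_mod_cast hk
  have h2 : (3 / 4 : ℝ) ^ (12 * Nat.clog 2 k + 18) = ((3 / 4) ^ 3) ^ (4 * Nat.clog 2 k + 6) := by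
    rw [← pow_mul]
    congr 1
    ring
  rw [h2]
  calc ((3 / 4 : ℝ) ^ 3) ^ (4 * Nat.clog 2 k + 6) ≤ (1 / 2) ^ (4 * Nat.clog 2 k + 6) :=
        pow_le_pow_left₀ (by norm_num) (by norm_num) _
    _ = (1 / (8 * ((2 : ℝ) ^ Nat.clog 2 k) ^ 2)) ^ 2 := by
        rw [one_div_pow, pow_add, pow_mul']
        ring
    _ ≤ (1 / (8 * k ^ 2)) ^ 2 := by gcongr

theorem clog_le_two_mul_logb {k : ℕ} (hk : 2 ≤ k) : (Nat.clog 2 k : ℝ) ≤ 2 * Real.logb 2 k := by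
  have hk0 : (0 : ℝ) < k := by exact_mod_cast (by omega : 0 < k)
  have h1 : (1 : ℝ) ≤ Real.logb 2 k := by
    rw [Real.le_logb_iff_rpow_le one_lt_two hk0]
    simpa using (by exact_mod_cast hk : (2 : ℝ) ≤ k)
  have h2 : ((Nat.clog 2 k - 1 : ℕ) : ℝ) ≤ Real.logb 2 k := by
    rw [Real.le_logb_iff_rpow_le one_lt_two hk0, Real.rpow_natCast]
    exact_mod_cast (Nat.pow_pred_clog_lt_self one_lt_two hk).le
  have h3 : (Nat.clog 2 k : ℝ) ≤ ((Nat.clog 2 k - 1 : ℕ) : ℝ) + 1 := by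
    exact_mod_cast (by omega : Nat.clog 2 k ≤ Nat.clog 2 k - 1 + 1)
  linarith

end Protocol

theorem mainTheorem4 :
    ∃ C : ℝ, 0 < C ∧ ∀ k d : ℕ, 1 ≤ d →
      ∃ P : QuantumSMP k k (Finset (Finset (Fin k))),
        (P.cost : ℝ) ≤ C * k * d * (Real.logb 2 k) ^ 2 ∧
          P.SolvesNIH (maxIsolatedCliques d) := by
  classical
  -- 520 = 130 · 4: the factor 130 bounds the message length in terms of d and the square of the
  -- rounded-up logarithm, and 4 is the price of l ≤ 2 log₂ k.
  refine ⟨520, by norm_num, fun k d hd => ?_⟩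
  -- For k ≤ 1 the bound is 0, through the factor k or through log₂ 1 = 0, so a protocol without
  -- communication is needed.
  rcases Nat.lt_or_ge k 2 with hk | hk
  · obtain ⟨P, hP, hs⟩ := exists_protocol_of_subsingleton (by omega : k ≤ 1) (maxIsolatedCliques d)
    exact ⟨P, by rw [hP]; simp; positivity, hs⟩
  -- The extra 1 in the exponent doubles 2^l ≥ k, which gives a field with at least 2k elements.
  · have : Fintype (GaloisField 2 (Nat.clog 2 k + 1)) := Fintype.ofFinite _
    have hF : Fintype.card (GaloisField 2 (Nat.clog 2 k + 1)) = 2 ^ (Nat.clog 2 k + 1) := by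
      rw [← Nat.card_eq_fintype_card, GaloisField.card 2 _ (Nat.succ_ne_zero _)]
    obtain ⟨P, hP, hs⟩ := exists_protocol_maxIsolatedCliques (d := d) (by omega : 1 ≤ k) hF
      (by rw [hF, pow_succ]; have := Nat.le_pow_clog one_lt_two k; omega)
      (three_fourths_pow_le (by omega))
    refine ⟨P, ?_, hs⟩
    rw [hP]
    have hl : 1 ≤ Nat.clog 2 k := Nat.clog_pos one_lt_two hk
    have hlog := clog_le_two_mul_logb hk
    set l := Nat.clog 2 k
    -- As d, l ≥ 1, the second factor 37 + 4d + 24l is at most (37 + 4 + 24)dl = 65dl, and l + 1 ≤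
    -- 2l.
    have hnat : (l + 1) * (1 + 4 * d + 2 * (12 * l + 18)) ≤ 130 * d * l ^ 2 := by
      calc (l + 1) * (1 + 4 * d + 2 * (12 * l + 18)) ≤ (2 * l) * (65 * (d * l)) := by
            refine Nat.mul_le_mul (by omega) ?_
            nlinarith [Nat.mul_le_mul hd hl]
        _ = 130 * d * l ^ 2 := by ring
    have hl2 : (l : ℝ) ^ 2 ≤ 4 * Real.logb 2 k ^ 2 := by
      have := pow_le_pow_left₀ (Nat.cast_nonneg l) hlog 2
      linarith
    calc ((k * ((l + 1) * (1 + 4 * d + 2 * (12 * l + 18))) : ℕ) : ℝ)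
        ≤ ((k * (130 * d * l ^ 2) : ℕ) : ℝ) := by exact_mod_cast Nat.mul_le_mul_left k hnat
      _ = 130 * k * d * (l : ℝ) ^ 2 := by push_cast; ring
      _ ≤ 130 * k * d * (4 * Real.logb 2 k ^ 2) := by gcongr
      _ = 520 * k * d * Real.logb 2 k ^ 2 := by ring
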